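/- For a permutation $\sigma=\sigma_1\cdots\sigma_n$ of $\{1,\dots,n\}$ let $\mathrm{des}(\sigma)$ be the number of $i\in\{1,\dots,n-1\}$ with $\sigma_i>\sigma_{i+1}$, and let $132\text{-mch}(\sigma)$ be the number of $i\in\{1,\dots,n-2\}$ with $\sigma_i<\sigma_{i+2}<\sigma_{i+1}$ (consecutive $132$-matches). Let $\mathcal S_n(123)$ be the set of permutations $\sigma$ of $\{1,\dots,n\}$ for which there are no indices $i<j<l$ with $\sigma_i<\sigma_j<\sigma_l$. Then the generating function $$A=A(t,y,x)=\sum_{n\ge 0}t^n\sum_{\sigma\in\mathcal S_n(123)}y^{\mathrm{des}(\sigma)}x^{132\text{-mch}(\sigma)}\in\mathbb Z[y,x][[t]]$$ satisfies $$A=1+\bigl(t+t^2(1-y)\bigr)\bigl(y(A-1)+1\bigr)^2+t^3(x-1)\,y\,\bigl(y(A-1)+1\bigr)^3 .$$ Moreover, for all integers $n\ge 0$ and $k\ge 1$, the coefficient of $t^nx^k$ in $A(t,1,x)$ is $$\frac1k\sum_{i=k}^{\lfloor n/3\rfloor}(-1)^{i-k}\binom{2n-3i}{n-3i,\;n+1-i,\;k-1,\;i-k},$$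 where $\binom{a+b+c+d}{a,\,b,\,c,\,d}=\frac{(a+b+c+d)!}{a!\,b!\,c!\,d!}$ and an empty sum is $0$. -/

import Mathlib

namespace ConsecPattern

/-- The word `w 0, …, w (k-1)` of distinct letters reduces to the permutation `p`: its letters are
in the same relative order as those of `p`. -/
def ReducesTo {α : Type*} [LinearOrder α] {k : ℕ} (w : Fin k → α) (p : Equiv.Perm (Fin k)) : Prop :=
  ∀ a b : Fin k, w a < w b ↔ p a < p b

instance {α : Type*} [LinearOrder α] {k : ℕ} (w : Fin k → α) (p : Equiv.Perm (Fin k)) :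
    Decidable (ReducesTo w p) :=
  inferInstanceAs (Decidable (∀ a b : Fin k, w a < w b ↔ p a < p b))

/-- The classical pattern `p` occurs in `s` (at increasing, not necessarily adjacent, positions). -/
def Occurs {k n : ℕ} (p : Equiv.Perm (Fin k)) (s : Equiv.Perm (Fin n)) : Prop :=
  ∃ f : Fin k → Fin n, (∀ a b : Fin k, a < b → f a < f b) ∧ ReducesTo (fun a => s (f a)) p

instance {k n : ℕ} (p : Equiv.Perm (Fin k)) (s : Equiv.Perm (Fin n)) : Decidable (Occurs p s) :=
  inferInstanceAs (Decidable (∃ f : Fin k → Fin n,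
    (∀ a b : Fin k, a < b → f a < f b) ∧ ReducesTo (fun a => s (f a)) p))

/-- The set of permutations of length `n` that avoid the classical pattern `p`. -/
def avoiders {k : ℕ} (n : ℕ) (p : Equiv.Perm (Fin k)) : Finset (Equiv.Perm (Fin n)) :=
  Finset.univ.filter fun s => ¬ Occurs p s

/-- The number of descents of `s`. -/
def des {n : ℕ} (s : Equiv.Perm (Fin n)) : ℕ :=
  ((Finset.range n).filter fun i =>
    ∃ h : i + 1 < n, s ⟨i + 1, h⟩ < s ⟨i, Nat.lt_of_succ_lt h⟩).card

/-- The number of consecutive `g`-matches of `s`, counted by their (zero-based) starting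
position. -/
def mch {k n : ℕ} (g : Equiv.Perm (Fin k)) (s : Equiv.Perm (Fin n)) : ℕ :=
  ((Finset.range n).filter fun i =>
    ∃ h : i + k ≤ n, ReducesTo
      (fun a : Fin k => s ⟨i + a, Nat.lt_of_lt_of_le (Nat.add_lt_add_left a.isLt i) h⟩) g).card

/-- The generating function `∑ₙ tⁿ ∑ y ^ des(s) x ^ mch(s)`, with `s` running over the permutations
of length `n` that avoid `p`; it is a power series in `t`, and `y`, `x` are elements (for instance
indeterminates) of the coefficient ring. -/
noncomputable def genFun {R : Type*} [CommRing R] {k l : ℕ} (p : Equiv.Perm (Fin k))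
    (g : Equiv.Perm (Fin l)) (y x : R) : PowerSeries R :=
  PowerSeries.mk fun n => ∑ s ∈ avoiders n p, y ^ des s * x ^ mch g s

/-- The permutation `123`. -/
def p123 : Equiv.Perm (Fin 3) := 1

/-- The permutation `132`. -/
def p132 : Equiv.Perm (Fin 3) := Equiv.swap 1 2

/-- The indeterminate `y` of `ℤ[y, x]`. -/
noncomputable def yVar : MvPolynomial (Fin 2) ℤ := MvPolynomial.X 0

/-- The indeterminate `x` of `ℤ[y, x]`. -/
noncomputable def xVar : MvPolynomial (Fin 2) ℤ := MvPolynomial.X 1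

/-- The generating function `A(t, y, x)` of the `123`-avoiding permutations by length (`t`),
descents (`y`) and consecutive `132`-matches (`x`), in `ℤ[y, x]⟦t⟧`. -/
noncomputable def A : PowerSeries (MvPolynomial (Fin 2) ℤ) := genFun p123 p132 yVar xVar

/-- The specialization `A(t, 1, x)`, in `ℤ[x]⟦t⟧`. -/
noncomputable def AOne : PowerSeries (Polynomial ℤ) :=
  PowerSeries.map (MvPolynomial.aeval ![(1 : Polynomial ℤ), Polynomial.X]).toRingHom A

end ConsecPattern

/-! A permutation is built from right to left: prepending `p` to a 123-avoider `τ` of length `n`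
keeps it 123-avoiding exactly when the values of `τ` that are at least `p` decrease. For `n > 0` and
such `p`, the new descent or match depends only on `n - p` and on `r = topRun τ`. The state `(k, r)`
with `k = n - threshold τ` therefore suffices: the new maximum leads to `(k + 1, min (r + 1) 2)`,
and the value `n - i` with `1 ≤ i ≤ k` leads to `(i, 0)`.

The series of extension weights, one per state, satisfy a linear system with a unique solution. If
`S` solves the equation expected of `A - 1`, then that solution is geometric in `k` with ratio `B =
1 + y S`, and state `(1, 1)`, that of the one-letter permutation, gives back `S`.

At `y = 1`, replacing `x` by `x + 1` turns the equation into `D = 1 + t D² + t³ x D³`, whose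
solution counts plane trees with binary and ternary inner vertices. Their closed form follows from a
recurrence on powers of `D`; substituting `x - 1` back creates the alternating sum. -/

namespace ConsecPattern

/-! ### Prepending a letter: avoidance, descents and matches -/

/-- Prepend the value `p` to `τ`, shifting up the values that are at least `p`. -/
def prepend {n : ℕ} (p : Fin (n + 1)) (τ : Equiv.Perm (Fin n)) : Equiv.Perm (Fin (n + 1)) :=
  ((finSuccEquiv' 0).trans (Equiv.optionCongr τ)).trans (finSuccEquiv' p).symm

@[simp] theorem prepend_zero {n : ℕ} (p : Fin (n + 1)) (τ : Equiv.Perm (Fin n)) :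
    prepend p τ 0 = p := by
  simp [prepend]

@[simp] theorem prepend_succ {n : ℕ} (p : Fin (n + 1)) (τ : Equiv.Perm (Fin n)) (i : Fin n) :
    prepend p τ i.succ = p.succAbove (τ i) := by
  have : finSuccEquiv' (0 : Fin (n + 1)) i.succ = some i := by
    rw [← Fin.succAbove_zero, finSuccEquiv'_succAbove]
  simp [prepend, this]

theorem prepend_bijective (n : ℕ) :
    Function.Bijective fun q : Fin (n + 1) × Equiv.Perm (Fin n) => prepend q.1 q.2 := by
  rw [Fintype.bijective_iff_injective_and_card]
  refine ⟨?_, by simp [Fintype.card_perm, Nat.factorial_succ]⟩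
  rintro ⟨p, τ⟩ ⟨p', τ'⟩ h
  have h' : ∀ i, prepend p τ i = prepend p' τ' i := fun i => DFunLike.congr_fun h i
  obtain rfl : p = p' := by simpa using h' 0
  refine Prod.ext rfl (Equiv.ext fun i => ?_)
  simpa using h' i.succ

theorem coe_succAbove {n : ℕ} (p : Fin (n + 1)) (i : Fin n) :
    (p.succAbove i : ℕ) = if (i : ℕ) < p then (i : ℕ) else i + 1 := by
  unfold Fin.succAbove
  simp only [Fin.lt_def, Fin.val_castSucc]
  split_ifs <;> simp

/-- The values of `τ` that are at least `p` appear in decreasing order. -/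
def Allowed {n : ℕ} (τ : Equiv.Perm (Fin n)) (p : ℕ) : Prop :=
  ∀ a b : Fin n, a < b → p ≤ (τ a : ℕ) → τ b < τ a

theorem occurs_p123_iff {n : ℕ} (s : Equiv.Perm (Fin n)) :
    Occurs p123 s ↔ ∃ a b c : Fin n, a < b ∧ b < c ∧ s a < s b ∧ s b < s c := by
  constructor
  · rintro ⟨f, hf, hr⟩
    exact ⟨f 0, f 1, f 2, hf _ _ (by decide), hf _ _ (by decide),
      (hr 0 1).2 (by decide), (hr 1 2).2 (by decide)⟩
  · rintro ⟨a, b, c, hab, hbc, h1, h2⟩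
    refine ⟨![a, b, c], ?_, ?_⟩
    · intro i j hij
      fin_cases i <;> fin_cases j <;> simp_all [hab.trans hbc]
    · intro i j
      have h3 := h1.trans h2
      fin_cases i <;> fin_cases j <;> simp [p123, h1, h2, h3, h1.le, h2.le, h3.le]

theorem reducesTo_p132_iff (w : Fin 3 → ℕ) :
    ReducesTo w p132 ↔ w 0 < w 2 ∧ w 2 < w 1 := by
  constructor
  · intro h
    exact ⟨(h 0 2).2 (by decide), (h 2 1).2 (by decide)⟩
  · rintro ⟨h1, h2⟩ i j
    have e0 : p132 0 = 0 := by decide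
    have e1 : p132 1 = 2 := by decide
    have e2 : p132 2 = 1 := by decide
    fin_cases i <;> fin_cases j <;> simp [e0, e1, e2] <;> omega

/-- A 123 starting at the new letter is an ascent of `τ` among the values at least `p`, since these
are the ones shifted above it. -/
theorem mem_avoiders_prepend {n : ℕ} (p : Fin (n + 1)) (τ : Equiv.Perm (Fin n)) :
    prepend p τ ∈ avoiders (n + 1) p123 ↔ τ ∈ avoiders n p123 ∧ Allowed τ p := by
  simp only [avoiders, Finset.mem_filter, Finset.mem_univ, true_and, occurs_p123_iff]
  constructor
  · intro h
    refine ⟨?_, ?_⟩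
    · rintro ⟨a, b, c, hab, hbc, h1, h2⟩
      exact h ⟨a.succ, b.succ, c.succ, by simpa using hab, by simpa using hbc,
        by simpa using h1, by simpa using h2⟩
    · intro a b hab hp
      by_contra hlt
      have h2 : τ a < τ b := lt_of_le_of_ne (not_lt.1 hlt) fun h => hab.ne (τ.injective h)
      refine h ⟨0, a.succ, b.succ, Fin.succ_pos _, by simpa using hab, ?_, by simpa using h2⟩
      rw [prepend_zero, prepend_succ, Fin.lt_def, coe_succAbove]
      split_ifs <;> omega
  · rintro ⟨h, hp⟩ ⟨a, b, c, hab, hbc, h1, h2⟩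
    obtain ⟨b, rfl⟩ := Fin.exists_succ_eq.2 (Fin.ne_zero_of_lt hab)
    obtain ⟨c, rfl⟩ := Fin.exists_succ_eq.2 (Fin.ne_zero_of_lt hbc)
    simp only [prepend_succ, Fin.succAbove_lt_succAbove_iff, Fin.succ_lt_succ_iff] at h2 hbc
    cases a using Fin.cases with
    | zero =>
      rw [prepend_zero, prepend_succ, Fin.lt_def, coe_succAbove] at h1
      refine (hp b c hbc ?_).not_gt h2
      split_ifs at h1 <;> omega
    | succ a =>
      simp only [prepend_succ, Fin.succAbove_lt_succAbove_iff, Fin.succ_lt_succ_iff] at h1 hab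
      exact h ⟨a, b, c, hab, hbc, h1, h2⟩

theorem card_filter_range_succ (n : ℕ) (P : ℕ → Prop) [DecidablePred P] :
    ((Finset.range (n + 1)).filter P).card =
      (if P 0 then 1 else 0) + ((Finset.range n).filter fun i => P (i + 1)).card := by
  simp only [Finset.card_filter, Finset.sum_range_succ', add_comm]

theorem des_prepend {n : ℕ} (p : Fin (n + 1)) (τ : Equiv.Perm (Fin n)) :
    des (prepend p τ) = (if ∃ h : 0 < n, (τ ⟨0, h⟩ : ℕ) < p then 1 else 0) + des τ := by
  unfold des
  rw [card_filter_range_succ]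
  congr 1
  · refine if_congr ?_ rfl rfl
    refine ⟨fun ⟨h, h'⟩ => ⟨by omega, ?_⟩, fun ⟨h, h'⟩ => ⟨by omega, ?_⟩⟩
    · change prepend p τ (Fin.succ ⟨0, by omega⟩) < prepend p τ 0 at h'
      rw [prepend_zero, prepend_succ, Fin.lt_def, coe_succAbove] at h'
      split_ifs at h' <;> omega
    · change prepend p τ (Fin.succ ⟨0, by omega⟩) < prepend p τ 0
      rw [prepend_zero, prepend_succ, Fin.lt_def, coe_succAbove, if_pos h']
      exact h'
  · congr 1
    refine Finset.filter_congr fun i _ => ?_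
    have key : ∀ h : i + 1 < n, prepend p τ (Fin.succ ⟨i + 1, h⟩) <
        prepend p τ (Fin.succ ⟨i, by omega⟩) ↔ τ ⟨i + 1, h⟩ < τ ⟨i, by omega⟩ := by
      intro h
      simp only [prepend_succ, Fin.succAbove_lt_succAbove_iff]
    exact ⟨fun ⟨h, h'⟩ => ⟨by omega, (key (by omega)).1 h'⟩,
      fun ⟨h, h'⟩ => ⟨by omega, (key h).2 h'⟩⟩

theorem mch_p132_eq {n : ℕ} (s : Equiv.Perm (Fin n)) :
    mch p132 s = ((Finset.range n).filter fun i => ∃ h : i + 2 < n,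
      s ⟨i, by omega⟩ < s ⟨i + 2, h⟩ ∧ s ⟨i + 2, h⟩ < s ⟨i + 1, by omega⟩).card := by
  unfold mch
  congr 1
  refine Finset.filter_congr fun i _ => ?_
  exact exists_congr fun h => reducesTo_p132_iff (fun a => (s ⟨i + a, by omega⟩ : ℕ))

theorem mch_prepend {n : ℕ} (p : Fin (n + 1)) (τ : Equiv.Perm (Fin n)) :
    mch p132 (prepend p τ) =
      (if ∃ h : 1 < n, (p : ℕ) ≤ (τ ⟨1, h⟩ : ℕ) ∧ τ ⟨1, h⟩ < τ ⟨0, by omega⟩ then 1 else 0) +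
        mch p132 τ := by
  rw [mch_p132_eq, mch_p132_eq, card_filter_range_succ]
  congr 1
  · refine if_congr ?_ rfl rfl
    have key : ∀ h : 1 < n, (prepend p τ 0 < prepend p τ (Fin.succ ⟨1, h⟩) ∧
        prepend p τ (Fin.succ ⟨1, h⟩) < prepend p τ (Fin.succ ⟨0, by omega⟩)) ↔
        ((p : ℕ) ≤ (τ ⟨1, h⟩ : ℕ) ∧ τ ⟨1, h⟩ < τ ⟨0, by omega⟩) := by
      intro h
      simp only [prepend_zero, prepend_succ, Fin.succAbove_lt_succAbove_iff]
      refine and_congr_left fun _ => ?_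
      rw [Fin.lt_def, coe_succAbove]
      split_ifs <;> omega
    exact ⟨fun ⟨h, h'⟩ => ⟨by omega, (key (by omega)).1 h'⟩,
      fun ⟨h, h'⟩ => ⟨by omega, (key h).2 h'⟩⟩
  · congr 1
    refine Finset.filter_congr fun i _ => ?_
    have key : ∀ h : i + 2 < n, (prepend p τ (Fin.succ ⟨i, by omega⟩) <
          prepend p τ (Fin.succ ⟨i + 2, h⟩) ∧
        prepend p τ (Fin.succ ⟨i + 2, h⟩) < prepend p τ (Fin.succ ⟨i + 1, by omega⟩)) ↔
        (τ ⟨i, by omega⟩ < τ ⟨i + 2, h⟩ ∧ τ ⟨i + 2, h⟩ < τ ⟨i + 1, by omega⟩) := by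
      intro h
      simp only [prepend_succ, Fin.succAbove_lt_succAbove_iff]
    exact ⟨fun ⟨h, h'⟩ => ⟨by omega, (key (by omega)).1 h'⟩,
      fun ⟨h, h'⟩ => ⟨by omega, (key h).2 h'⟩⟩

end ConsecPattern

/-! ### The functional equation and the linear system for the states -/

namespace ConsecPattern
open PowerSeries

/-- A map of power series that raises the order of agreement has a fixed point. -/
theorem exists_fixedPoint_of_contracting {R : Type*} [CommRing R]
    (Φ : PowerSeries R → PowerSeries R)
    (hΦ : ∀ n f g, (X : PowerSeries R) ^ n ∣ f - g → (X : PowerSeries R) ^ (n + 1) ∣ Φ f - Φ g) :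
    ∃ f, Φ f = f := by
  have step : ∀ n, (X : PowerSeries R) ^ n ∣ Φ^[n + 1] 0 - Φ^[n] 0 := by
    intro n
    induction n with
    | zero => simp
    | succ n ih =>
      rw [Function.iterate_succ_apply' Φ (n + 1), Function.iterate_succ_apply' Φ n]
      exact hΦ n _ _ (by simpa only [Function.iterate_succ_apply'] using ih)
  have stable : ∀ n m, (X : PowerSeries R) ^ n ∣ Φ^[n + m] 0 - Φ^[n] 0 := by
    intro n m
    induction m with
    | zero => simp
    | succ m ih =>
      have h := (pow_dvd_pow X (Nat.le_add_right n m)).trans (step (n + m))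
      simpa [add_assoc] using dvd_add h ih
  -- The iterates from index `n + 1` on agree modulo `X ^ (n + 1)`, so coefficient `n` is final
  -- there.
  let f : PowerSeries R := mk fun n => coeff n (Φ^[n + 1] 0)
  have hf : ∀ n, (X : PowerSeries R) ^ n ∣ f - Φ^[n] 0 := by
    intro n
    rw [X_pow_dvd_iff]
    intro i hi
    have h := X_pow_dvd_iff.1 (stable (i + 1) (n - (i + 1))) i (by omega)
    rw [show i + 1 + (n - (i + 1)) = n by omega] at h
    simp only [map_sub, f, coeff_mk] at h ⊢
    rw [← neg_sub, h, neg_zero]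
  refine ⟨f, sub_eq_zero.1 <| PowerSeries.ext fun n => ?_⟩
  have h1 := hΦ n _ _ (hf n)
  rw [← Function.iterate_succ_apply' Φ n] at h1
  have h2 := dvd_sub h1 (hf (n + 1))
  rw [sub_sub_sub_cancel_right] at h2
  simpa using X_pow_dvd_iff.1 h2 n (Nat.lt_succ_self n)

theorem exists_solution {R : Type*} [CommRing R] (y x : R) :
    ∃ S : PowerSeries R, S = (X + X ^ 2 * (1 - C y)) * (C y * S + 1) ^ 2
        + X ^ 3 * (C x - 1) * C y * (C y * S + 1) ^ 3 := by
  obtain ⟨S, hS⟩ := exists_fixedPoint_of_contracting (R := R)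
    (fun S => (X + X ^ 2 * (1 - C y)) * (C y * S + 1) ^ 2
        + X ^ 3 * (C x - 1) * C y * (C y * S + 1) ^ 3) (by
      rintro n f g ⟨d, hd⟩
      obtain rfl : f = g + X ^ n * d := by rw [← hd]; ring
      refine ⟨C y * d * ((1 + X * (1 - C y)) * (C y * (g + X ^ n * d) + 1 + (C y * g + 1))
        + X ^ 2 * (C x - 1) * C y * ((C y * (g + X ^ n * d) + 1) ^ 2
          + (C y * (g + X ^ n * d) + 1) * (C y * g + 1) + (C y * g + 1) ^ 2)), ?_⟩
      ring)
  exact ⟨S, hS.symm⟩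

/-- The weight of prepending the `i`-th largest non-maximal value in state `r`. -/
def stepWeight {R : Type*} [CommRing R] (y x : R) (r i : ℕ) : R :=
  if r = 0 then y else if r = 2 ∧ 2 ≤ i then x else 1

/-- The total weight of the extensions by `n` steps from the state `(k, r)`. -/
def extWeight {R : Type*} [CommRing R] (y x : R) : ℕ → ℕ → ℕ → R
  | 0, _, _ => 1
  | n + 1, k, r => y * extWeight y x n (k + 1) (min (r + 1) 2) +
      ∑ i ∈ Finset.Icc 1 k, stepWeight y x r i * extWeight y x n i 0

/-- The factor `X` makes each coefficient depend only on earlier ones, so any solution of the system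
is the series of extension weights. -/
theorem extWeight_unique {R : Type*} [CommRing R] (y x : R) (V : ℕ → ℕ → PowerSeries R)
    (hV : ∀ k r, r ≤ 2 → V k r = 1 + X * (C y * V (k + 1) (min (r + 1) 2) +
      ∑ i ∈ Finset.Icc 1 k, C (stepWeight y x r i) * V i 0)) (n k r : ℕ) (hr : r ≤ 2) :
    coeff n (V k r) = extWeight y x n k r := by
  induction n generalizing k r with
  | zero => rw [hV k r hr]; simp [extWeight]
  | succ n ih =>
    rw [hV k r hr, extWeight]
    simp only [map_add, coeff_one, coeff_succ_X_mul, map_sum, coeff_C_mul]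
    rw [ih _ _ (by omega)]
    simp [ih]

theorem extWeight_series {R : Type*} [CommRing R] (y x : R) (S : PowerSeries R)
    (hS : S = (X + X ^ 2 * (1 - C y)) * (C y * S + 1) ^ 2
        + X ^ 3 * (C x - 1) * C y * (C y * S + 1) ^ 3) (n : ℕ) :
    extWeight y x n 1 1 = coeff (n + 1) S := by
  obtain ⟨B, hB⟩ : ∃ B, B = C y * S + 1 := ⟨_, rfl⟩
  rw [← hB] at hS
  have hu : IsUnit (1 - X * C y * B : PowerSeries R) := by
    rw [isUnit_iff_constantCoeff]; simp
  obtain ⟨q, hq⟩ := hu.exists_right_inv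
  obtain ⟨c₂, hc₂⟩ : ∃ c, c = X * C x * B * q := ⟨_, rfl⟩
  obtain ⟨c₁, hc₁⟩ : ∃ c, c = X * C y * B * c₂ + X * B := ⟨_, rfl⟩
  have h2 : c₂ = X * C y * B * c₂ + X * C x * B := by
    rw [hc₂]; linear_combination X * C x * B * hq
  have hSc : S = X * (B + c₁ * B) := by
    have h1 : (1 - X * C y * B) * S = (1 - X * C y * B) * (X * (B + c₁ * B)) := by
      rw [hc₁]
      linear_combination hS + X * B * hB - X ^ 2 * C y * B ^ 2 * h2
    exact hu.mul_left_cancel h1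
  -- Raising `k` adds one summand to each equation, which suggests increments in `k` that are
  -- geometric with ratio `B`, with factors `c₁` and `c₂` for `r = 1, 2`. For `r = 2` the first
  -- increment carries `c₁`, because the weight at `i = 1` is `1` and not `x`.
  let V : ℕ → ℕ → PowerSeries R := fun k r =>
    if r = 0 then B ^ (k + 1) else if r = 1 then B + c₁ * ∑ i ∈ Finset.Icc 1 k, B ^ i
    else B + ∑ i ∈ Finset.Icc 1 k, if i = 1 then c₁ * B else c₂ * B ^ i
  have hB' : B = 1 + X * C y * (B + c₁ * B) := by linear_combination hB + C y * hSc
  have hV : ∀ k r, r ≤ 2 → V k r = 1 + X * (C y * V (k + 1) (min (r + 1) 2) +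
      ∑ i ∈ Finset.Icc 1 k, C (stepWeight y x r i) * V i 0) := by
    intro k r hr
    induction k with
    | zero =>
      interval_cases r <;> simp [V] <;> linear_combination hB'
    | succ k ih =>
      interval_cases r
      · simp [V, stepWeight, Finset.sum_Icc_succ_top] at ih ⊢
        linear_combination ih + B ^ (k + 1) * hB'
      · simp [V, stepWeight, Finset.sum_Icc_succ_top] at ih ⊢
        linear_combination ih + B ^ (k + 1) * hc₁
      · rcases k with _ | k
        · simp [V, stepWeight, Finset.sum_Icc_succ_top] at ih ⊢
          linear_combination ih + B * hc₁
        · simp [V, stepWeight, Finset.sum_Icc_succ_top] at ih ⊢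
          linear_combination ih + B ^ (k + 2) * h2
  rw [← extWeight_unique y x V hV n 1 1 (by omega), hSc, coeff_succ_X_mul]
  simp [V]

end ConsecPattern

/-! ### The state of a permutation and its transitions -/

namespace ConsecPattern

/-- The least `p` for which the values of `τ` that are at least `p` appear in decreasing order. -/
noncomputable def threshold {n : ℕ} (τ : Equiv.Perm (Fin n)) : ℕ := sInf {p | Allowed τ p}

theorem allowed_length {n : ℕ} (τ : Equiv.Perm (Fin n)) : Allowed τ n :=
  fun a _ _ h => absurd (τ a).isLt (by omega)

theorem allowed_iff {n : ℕ} (τ : Equiv.Perm (Fin n)) (p : ℕ) :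
    Allowed τ p ↔ threshold τ ≤ p := by
  refine ⟨fun h => Nat.sInf_le h, fun h a b hab hp => ?_⟩
  have hm : Allowed τ (threshold τ) := Nat.sInf_mem (s := {p | Allowed τ p}) ⟨n, allowed_length τ⟩
  exact hm a b hab (h.trans hp)

theorem threshold_le {n : ℕ} (τ : Equiv.Perm (Fin n)) : threshold τ ≤ n :=
  (allowed_iff τ n).1 (allowed_length τ)

theorem threshold_eq {n : ℕ} {τ : Equiv.Perm (Fin n)} {e : ℕ} (h : ∀ p, Allowed τ p ↔ e ≤ p) :
    threshold τ = e :=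
  le_antisymm ((allowed_iff τ e).1 ((h e).2 le_rfl))
    ((h _).1 ((allowed_iff τ _).2 le_rfl))

theorem threshold_prepend_last {n : ℕ} (τ : Equiv.Perm (Fin n)) :
    threshold (prepend (Fin.last n) τ) = threshold τ := by
  refine threshold_eq fun q => (Iff.trans ?_ (allowed_iff τ q))
  constructor
  · intro h a b hab hq
    simpa using h a.succ b.succ (by simpa using hab) (by simpa using hq)
  · intro h a b hab hq
    obtain ⟨b, rfl⟩ := Fin.exists_succ_eq.2 (Fin.ne_zero_of_lt hab)
    cases a using Fin.cases with
    | zero => simp [Fin.castSucc_lt_last]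
    | succ a => simpa using h a b (by simpa using hab) (by simpa using hq)

/-- The new first letter precedes the maximum, so it must itself lie below any allowed bound; the
letters after it add no further constraint. -/
theorem threshold_prepend_castSucc {n : ℕ} (τ : Equiv.Perm (Fin n)) (p : Fin n)
    (hp : threshold τ ≤ p) : threshold (prepend p.castSucc τ) = p + 1 := by
  rw [← allowed_iff] at hp
  refine threshold_eq fun q => ⟨fun h => ?_, fun h => ?_⟩
  · by_contra hq
    obtain ⟨b, hb⟩ := τ.surjective ⟨n - 1, by omega⟩
    have hb' : (τ b : ℕ) = n - 1 := by rw [hb]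
    have := h 0 b.succ (Fin.succ_pos _) (by simp; omega)
    rw [prepend_zero, prepend_succ, Fin.lt_def, coe_succAbove, Fin.val_castSucc] at this
    split_ifs at this <;> omega
  · intro a b hab hq
    obtain ⟨b, rfl⟩ := Fin.exists_succ_eq.2 (Fin.ne_zero_of_lt hab)
    cases a using Fin.cases with
    | zero => rw [prepend_zero, Fin.val_castSucc] at hq; omega
    | succ a =>
      rw [prepend_succ, coe_succAbove, Fin.val_castSucc] at hq
      simp only [prepend_succ, Fin.succAbove_lt_succAbove_iff]
      exact hp a b (by simpa using hab) (by split_ifs at hq <;> omega)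

/-- The letter at position `j` is the `j`-th largest one, counted from zero. -/
def TopAt {n : ℕ} (τ : Equiv.Perm (Fin n)) (j : ℕ) : Prop :=
  ∃ h : j < n, (τ ⟨j, h⟩ : ℕ) + j + 1 = n

open Classical in
/-- The length, capped at two, of the initial run of largest letters in decreasing order. -/
noncomputable def topRun {n : ℕ} (τ : Equiv.Perm (Fin n)) : ℕ :=
  if TopAt τ 0 then if TopAt τ 1 then 2 else 1 else 0

theorem topRun_prepend_last {n : ℕ} (τ : Equiv.Perm (Fin n)) :
    topRun (prepend (Fin.last n) τ) = min (topRun τ + 1) 2 := by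
  have h0 : TopAt (prepend (Fin.last n) τ) 0 := ⟨by omega, by
    change ((prepend (Fin.last n) τ 0 : Fin (n + 1)) : ℕ) + 0 + 1 = n + 1
    simp⟩
  have key : ∀ h : 0 < n, ((prepend (Fin.last n) τ (Fin.succ ⟨0, h⟩) : Fin (n + 1)) : ℕ)
      = τ ⟨0, h⟩ := fun h => by rw [prepend_succ, Fin.succAbove_last, Fin.val_castSucc]
  have h1 : TopAt (prepend (Fin.last n) τ) 1 ↔ TopAt τ 0 :=
    ⟨fun ⟨h, h'⟩ => ⟨by omega, by rw [← key]; exact Nat.succ_injective h'⟩,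
      fun ⟨h, h'⟩ => ⟨by omega, by rw [← key] at h'; exact congrArg Nat.succ h'⟩⟩
  unfold topRun
  rw [if_pos h0]
  by_cases h : TopAt τ 0
  · rw [if_pos (h1.2 h), if_pos h]
    split_ifs <;> rfl
  · rw [if_neg (h1.not.2 h), if_neg h]
    rfl

theorem topRun_prepend_castSucc {n : ℕ} (τ : Equiv.Perm (Fin n)) (p : Fin n) :
    topRun (prepend p.castSucc τ) = 0 := by
  refine if_neg ?_
  rintro ⟨_, h⟩
  change ((prepend p.castSucc τ 0 : Fin (n + 1)) : ℕ) + 0 + 1 = n + 1 at h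
  rw [prepend_zero, Fin.val_castSucc] at h
  omega

/-- Otherwise the maximum, standing later, would form an ascent with the first letter among the
values at least `p`. -/
theorem not_topAt_zero {n : ℕ} {τ : Equiv.Perm (Fin n)} {p : ℕ} (hp : Allowed τ p)
    (h : 0 < n) (h0 : ¬ TopAt τ 0) : (τ ⟨0, h⟩ : ℕ) < p := by
  by_contra hlt
  obtain ⟨b, hb⟩ := τ.surjective ⟨n - 1, by omega⟩
  have hb' : (τ b : ℕ) = n - 1 := by rw [hb]
  have hne : b ≠ ⟨0, h⟩ := by
    rintro rfl
    exact h0 ⟨h, by omega⟩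
  have := hp ⟨0, h⟩ b (by
    rw [Fin.lt_def]; exact Nat.pos_of_ne_zero fun h => hne (Fin.ext h)) (by omega)
  rw [Fin.lt_def] at this
  omega

theorem not_topAt_one {n : ℕ} {τ : Equiv.Perm (Fin n)} {p : ℕ} (hp : Allowed τ p)
    (h : 1 < n) (h0 : TopAt τ 0) (h1 : ¬ TopAt τ 1) : (τ ⟨1, h⟩ : ℕ) < p := by
  by_contra hlt
  obtain ⟨_, h0⟩ := h0
  obtain ⟨b, hb⟩ := τ.surjective ⟨n - 2, by omega⟩
  have hb' : (τ b : ℕ) = n - 2 := by rw [hb]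
  have hne : (b : ℕ) ≠ 1 := by
    intro hb1
    obtain rfl : b = ⟨1, h⟩ := Fin.ext hb1
    exact h1 ⟨h, by omega⟩
  have hne0 : (b : ℕ) ≠ 0 := by
    intro hb1
    obtain rfl : b = ⟨0, by omega⟩ := Fin.ext hb1
    omega
  have hlt0 : (τ ⟨1, h⟩ : ℕ) ≠ n - 1 := by
    intro h2
    have : (⟨1, h⟩ : Fin n) = ⟨0, by omega⟩ := τ.injective (Fin.ext (by omega))
    simp at this
  have := hp ⟨1, h⟩ b (by rw [Fin.lt_def]; change 1 < (b : ℕ); omega) (by omega)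
  rw [Fin.lt_def] at this
  omega

/-! ### Weights along the transitions and the equation for the generating function -/

section Weights

variable {R : Type*} [CommRing R] (y x : R)

/-- The weight of a permutation. -/
def permWeight {n : ℕ} (s : Equiv.Perm (Fin n)) : R := y ^ des s * x ^ mch p132 s

theorem permWeight_prepend_last {n : ℕ} (hn : 0 < n) (τ : Equiv.Perm (Fin n)) :
    permWeight y x (prepend (Fin.last n) τ) = y * permWeight y x τ := by
  rw [permWeight, permWeight, des_prepend, mch_prepend,
    if_pos ⟨hn, by simp⟩, if_neg (by rintro ⟨h, h', _⟩; simp at h'; omega)]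
  ring

/-- If `τ` does not begin with its maximum, its first letter is below `p`: a descent and no match.
Otherwise there is no descent, and a match needs the second letter to be at least `p`, which forces
it to be the second largest and `n - p ≥ 2`. -/
theorem permWeight_prepend_castSucc {n : ℕ} (τ : Equiv.Perm (Fin n)) (p : Fin n)
    (hp : threshold τ ≤ p) :
    permWeight y x (prepend p.castSucc τ) =
      stepWeight y x (topRun τ) (n - p) * permWeight y x τ := by
  rw [← allowed_iff] at hp
  have hn : 0 < n := p.pos
  rw [permWeight, permWeight, des_prepend, mch_prepend]
  by_cases h0 : TopAt τ 0
  · have e0 := h0.2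
    have hd : ¬ ∃ h : 0 < n, (τ ⟨0, h⟩ : ℕ) < p.castSucc := by
      rintro ⟨h, h'⟩
      rw [Fin.val_castSucc] at h'
      omega
    rw [if_neg hd]
    by_cases h1 : TopAt τ 1
    · have e1 := h1.2
      have hr : topRun τ = 2 := by simp [topRun, h0, h1]
      rw [hr]
      by_cases hi : 2 ≤ n - p
      · rw [if_pos ⟨h1.1, by rw [Fin.val_castSucc]; omega, by rw [Fin.lt_def]; omega⟩]
        simp [stepWeight, hi]
        ring
      · rw [if_neg (by rintro ⟨h, h', _⟩; rw [Fin.val_castSucc] at h'; omega)]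
        simp [stepWeight, hi]
    · have hr : topRun τ = 1 := by simp [topRun, h0, h1]
      rw [hr, if_neg (by
        rintro ⟨h, h', _⟩
        have := not_topAt_one hp h h0 h1
        rw [Fin.val_castSucc] at h'
        omega)]
      simp [stepWeight]
  · have hr : topRun τ = 0 := by simp [topRun, h0]
    have hlt := not_topAt_zero hp hn h0
    rw [hr, if_pos ⟨hn, hlt⟩, if_neg (by
      rintro ⟨h, h', h''⟩
      rw [Fin.lt_def] at h''
      rw [Fin.val_castSucc] at h'
      omega)]
    simp [stepWeight]
    ring

theorem sum_avoiders_succ {M : Type*} [AddCommMonoid M] (n : ℕ)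
    (f : Equiv.Perm (Fin (n + 1)) → M) :
    ∑ s ∈ avoiders (n + 1) p123, f s = ∑ τ ∈ avoiders n p123,
      (f (prepend (Fin.last n) τ) +
        ∑ p : Fin n, if threshold τ ≤ p then f (prepend p.castSucc τ) else 0) := by
  have h1 : ∑ s ∈ avoiders (n + 1) p123, f s =
      ∑ s, if s ∈ avoiders (n + 1) p123 then f s else 0 := by simp
  have h2 : ∀ g : Equiv.Perm (Fin n) → M, ∑ τ ∈ avoiders n p123, g τ =
      ∑ τ, if τ ∈ avoiders n p123 then g τ else 0 := by simp
  rw [h1, h2, ← (prepend_bijective n).sum_comp, Fintype.sum_prod_type_right]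
  refine Finset.sum_congr rfl fun τ _ => ?_
  simp only [mem_avoiders_prepend, allowed_iff, Fin.sum_univ_castSucc, Fin.val_castSucc,
    Fin.val_last, threshold_le, and_true]
  by_cases h : τ ∈ avoiders n p123
  · simp only [h, true_and, if_true, add_comm]
  · simp [h]

theorem sum_threshold_le {M : Type*} [AddCommMonoid M] {n e : ℕ} (he : e ≤ n) (g : ℕ → M) :
    (∑ p : Fin n, if e ≤ p then g (n - p) else 0) = ∑ i ∈ Finset.Icc 1 (n - e), g i := by
  rw [Fin.sum_univ_eq_sum_range (fun p => if e ≤ p then g (n - p) else 0) n, ← Finset.sum_filter]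
  refine Finset.sum_bij' (fun p _ => n - p) (fun i _ => n - i) ?_ ?_ ?_ ?_ fun _ _ => rfl <;>
  · intro a ha
    simp only [Finset.mem_filter, Finset.mem_range, Finset.mem_Icc] at ha ⊢
    omega

/-- One extension step moves from the `extWeight` factor into the permutation. The empty permutation
is excluded because prepending to it creates no descent. -/
theorem sum_extWeight_succ (m : ℕ) {n : ℕ} (hn : 0 < n) :
    ∑ s ∈ avoiders (n + 1) p123,
        permWeight y x s * extWeight y x m (n + 1 - threshold s) (topRun s) =
      ∑ τ ∈ avoiders n p123,
        permWeight y x τ * extWeight y x (m + 1) (n - threshold τ) (topRun τ) := by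
  rw [sum_avoiders_succ]
  refine Finset.sum_congr rfl fun τ _ => ?_
  have hle := threshold_le τ
  have hsum : (∑ p : Fin n, if threshold τ ≤ p then
      permWeight y x (prepend p.castSucc τ) * extWeight y x m
        (n + 1 - threshold (prepend p.castSucc τ)) (topRun (prepend p.castSucc τ)) else 0) =
      ∑ p : Fin n, if threshold τ ≤ p then
        (stepWeight y x (topRun τ) (n - p) * permWeight y x τ) * extWeight y x m (n - p) 0
        else 0 := by
    refine Finset.sum_congr rfl fun p _ => ?_
    split_ifs with hp
    · rw [permWeight_prepend_castSucc y x τ p hp, threshold_prepend_castSucc τ p hp,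
        topRun_prepend_castSucc, Nat.add_sub_add_right]
    · rfl
  rw [hsum, sum_threshold_le hle fun i =>
      (stepWeight y x (topRun τ) i * permWeight y x τ) * extWeight y x m i 0,
    permWeight_prepend_last y x hn, threshold_prepend_last, topRun_prepend_last, extWeight,
    Nat.sub_add_comm hle, mul_add, Finset.mul_sum]
  congr 1
  · ring
  · exact Finset.sum_congr rfl fun i _ => by ring

theorem sum_permWeight_succ (n : ℕ) :
    ∑ s ∈ avoiders (n + 1) p123, permWeight y x s = extWeight y x n 1 1 := by
  -- The induction needs the statement with `m` steps still to come; `m = 0` is the claim.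
  have key : ∀ m, ∑ s ∈ avoiders (n + 1) p123,
      permWeight y x s * extWeight y x m (n + 1 - threshold s) (topRun s) =
        extWeight y x (n + m) 1 1 := by
    induction n with
    | zero =>
      intro m
      have h0 : avoiders 0 p123 = {1} := by decide
      have hp : ∀ s : Equiv.Perm (Fin 1), permWeight y x s = 1 := by
        intro s
        obtain rfl : s = 1 := Subsingleton.elim _ _
        have h1 : des (1 : Equiv.Perm (Fin 1)) = 0 := by decide
        have h2 : mch p132 (1 : Equiv.Perm (Fin 1)) = 0 := by decide
        rw [permWeight, h1, h2]; simp
      have ht : threshold (1 : Equiv.Perm (Fin 0)) = 0 := Nat.le_zero.1 (threshold_le _)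
      have hr : topRun (1 : Equiv.Perm (Fin 0)) = 0 := if_neg fun h => absurd h.1 (by omega)
      rw [sum_avoiders_succ, h0, Finset.sum_singleton, hp, threshold_prepend_last,
        topRun_prepend_last, ht, hr]
      simp
    | succ n ih =>
      intro m
      rw [sum_extWeight_succ y x m (Nat.succ_pos n), ih, Nat.add_right_comm, Nat.add_assoc]
  simpa [extWeight] using key 0

theorem genFun_eq : genFun p123 p132 y x =
    1 + (PowerSeries.X + PowerSeries.X ^ 2 * (1 - PowerSeries.C y)) *
        (PowerSeries.C y * (genFun p123 p132 y x - 1) + 1) ^ 2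
      + PowerSeries.X ^ 3 * (PowerSeries.C x - 1) * PowerSeries.C y *
        (PowerSeries.C y * (genFun p123 p132 y x - 1) + 1) ^ 3 := by
  obtain ⟨S, hS⟩ := exists_solution y x
  have h : genFun p123 p132 y x = 1 + S := by
    ext n
    rw [genFun, PowerSeries.coeff_mk]
    rcases n with _ | n
    · have h0 : avoiders 0 p123 = {1} := by decide
      have h1 : des (1 : Equiv.Perm (Fin 0)) = 0 := by decide
      have h2 : mch p132 (1 : Equiv.Perm (Fin 0)) = 0 := by decide
      have h3 : PowerSeries.coeff 0 S = 0 := by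
        rw [hS]
        simp
      rw [map_add, h3, h0, Finset.sum_singleton, h1, h2]
      simp
    · rw [map_add, ← extWeight_series y x S hS, PowerSeries.coeff_one, if_neg n.succ_ne_zero,
        zero_add]
      exact sum_permWeight_succ y x n
  rw [h, add_sub_cancel_left]
  linear_combination hS

end Weights

end ConsecPattern

/-! ### Counting forests and extracting coefficients at `y = 1` -/

namespace ConsecPattern
open Nat

/-- The number of plane forests of `m` trees with `b` binary and `j` ternary inner vertices. -/
def forestCount : ℕ → ℕ → ℕ → ℚ
  | 0, b, j => if b = 0 ∧ j = 0 then 1 else 0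
  | m + 1, b, j => (m + 1) * (2 * b + 3 * j + m)! / (b ! * j ! * (b + 2 * j + m + 1)!)

theorem forestCount_eq {m b j : ℕ} (N K : ℕ) (hN : N = 2 * b + 3 * j + m)
    (hK : K = b + 2 * j + m + 1) :
    forestCount (m + 1) b j = (m + 1) * N ! / (b ! * j ! * K !) := by
  subst hN hK; rfl

/-- Kept apart because the empty forest is not covered by the factorial formula. -/
theorem forestCount_one_recurrence (b j : ℕ) :
    forestCount 1 b j = forestCount 0 b j +
      (if 1 ≤ b then forestCount 2 (b - 1) j else 0) +
      (if 1 ≤ j then forestCount 3 b (j - 1) else 0) := by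
  rcases b with _ | b <;> rcases j with _ | j
  · simp [forestCount]
  · simp only [le_add_iff_nonneg_left, zero_le, if_true, add_tsub_cancel_right]
    rw [forestCount_eq (m := 0) (3 * j + 2 + 1) (2 * j + 3) (by ring) (by ring),
      forestCount_eq (m := 2) (3 * j + 2) (2 * j + 3) (by ring) (by ring)]
    simp [forestCount, factorial_succ]
    field_simp
    ring
  · simp only [le_add_iff_nonneg_left, zero_le, if_true, add_tsub_cancel_right]
    rw [forestCount_eq (m := 0) (2 * b + 1 + 1) (b + 2) (by ring) (by ring),
      forestCount_eq (m := 1) (2 * b + 1) (b + 2) (by ring) (by ring)]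
    simp [forestCount, factorial_succ]
    field_simp
    ring
  · simp only [le_add_iff_nonneg_left, zero_le, if_true, add_tsub_cancel_right]
    rw [forestCount_eq (m := 0) (2 * b + 3 * j + 4 + 1) (b + 2 * j + 4) (by ring) (by ring),
      forestCount_eq (m := 1) (2 * b + 3 * j + 4) (b + 2 * j + 4) (by ring) (by ring),
      forestCount_eq (m := 2) (2 * b + 3 * j + 4) (b + 2 * j + 4) (by ring) (by ring)]
    simp [forestCount, factorial_succ]
    field_simp
    ring

/-- In terms of forests: the first tree is a leaf, or its root is binary or ternary, and removing
the root leaves one tree less, one more or two more. -/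
theorem forestCount_recurrence (m b j : ℕ) :
    forestCount (m + 1) b j = forestCount m b j +
      (if 1 ≤ b then forestCount (m + 2) (b - 1) j else 0) +
      (if 1 ≤ j then forestCount (m + 3) b (j - 1) else 0) := by
  rcases m with _ | m
  · exact forestCount_one_recurrence b j
  have f : ∀ n : ℕ, (n ! : ℚ) ≠ 0 := fun n => by exact_mod_cast n.factorial_ne_zero
  rcases b with _ | b <;> rcases j with _ | j
  · simp [forestCount, factorial_succ]
    field_simp [f]
  · simp only [le_add_iff_nonneg_left, zero_le, if_true, add_tsub_cancel_right]
    rw [forestCount_eq (m := m + 1) (3 * j + m + 3 + 1) (2 * j + m + 3 + 1) (by ring) (by ring),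
      forestCount_eq (m := m) (3 * j + m + 3) (2 * j + m + 3) (by ring) (by ring),
      forestCount_eq (m := m + 3) (3 * j + m + 3) (2 * j + m + 3 + 1) (by ring) (by ring)]
    simp [factorial_succ]
    field_simp
    ring
  · simp only [le_add_iff_nonneg_left, zero_le, if_true, add_tsub_cancel_right]
    rw [forestCount_eq (m := m + 1) (2 * b + m + 2 + 1) (b + m + 2 + 1) (by ring) (by ring),
      forestCount_eq (m := m) (2 * b + m + 2) (b + m + 2) (by ring) (by ring),
      forestCount_eq (m := m + 2) (2 * b + m + 2) (b + m + 2 + 1) (by ring) (by ring)]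
    simp [factorial_succ]
    field_simp
    ring
  · simp only [le_add_iff_nonneg_left, zero_le, if_true, add_tsub_cancel_right]
    rw [forestCount_eq (m := m + 1) (2 * b + 3 * j + m + 5 + 1) (b + 2 * j + m + 4 + 1)
        (by ring) (by ring),
      forestCount_eq (m := m) (2 * b + 3 * j + m + 5) (b + 2 * j + m + 4) (by ring) (by ring),
      forestCount_eq (m := m + 2) (2 * b + 3 * j + m + 5) (b + 2 * j + m + 4 + 1)
        (by ring) (by ring),
      forestCount_eq (m := m + 3) (2 * b + 3 * j + m + 5) (b + 2 * j + m + 4 + 1)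
        (by ring) (by ring)]
    simp [factorial_succ]
    field_simp
    ring

open Polynomial in
theorem coeff_coeff_pow {A : PowerSeries ℚ[X]}
    (hA : A = 1 + PowerSeries.X * A ^ 2 + PowerSeries.X ^ 3 * PowerSeries.C X * A ^ 3)
    (m n j : ℕ) : (PowerSeries.coeff n (A ^ m)).coeff j =
      if 3 * j ≤ n then forestCount m (n - 3 * j) j else 0 := by
  induction n using Nat.strong_induction_on generalizing m j with
  | _ n ih =>
    induction m generalizing j with
    | zero =>
      rw [pow_zero, PowerSeries.coeff_one]
      by_cases hn : n = 0 <;> by_cases hj : j = 0 <;>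
        simp [hn, hj, forestCount, Polynomial.coeff_one]
    | succ m ihm =>
      -- The last two terms have smaller `n`, the first has smaller `m`: hence the nested
      -- inductions.
      have h : A ^ (m + 1) = A ^ m + PowerSeries.X ^ 1 * A ^ (m + 2) +
          PowerSeries.C X * (PowerSeries.X ^ 3 * A ^ (m + 3)) := by
        linear_combination A ^ m * hA
      rw [h, map_add, map_add, PowerSeries.coeff_C_mul, PowerSeries.coeff_X_pow_mul',
        PowerSeries.coeff_X_pow_mul', Polynomial.coeff_add, Polynomial.coeff_add, ihm,
        forestCount_recurrence]
      have h1 : (if 1 ≤ n then PowerSeries.coeff (n - 1) (A ^ (m + 2)) else 0).coeff j =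
          if 1 + 3 * j ≤ n then forestCount (m + 2) (n - 3 * j - 1) j else 0 := by
        by_cases hn : 1 ≤ n
        · rw [if_pos hn, ih _ (by omega), Nat.sub_right_comm]
          exact if_congr (by omega) rfl rfl
        · rw [if_neg hn, if_neg (by omega), Polynomial.coeff_zero]
      have h3 : (X * if 3 ≤ n then PowerSeries.coeff (n - 3) (A ^ (m + 3)) else 0).coeff j =
          if 1 ≤ j ∧ 3 * j ≤ n then forestCount (m + 3) (n - 3 * j) (j - 1) else 0 := by
        rcases j with _ | j
        · rw [Polynomial.coeff_X_mul_zero, if_neg (by omega)]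
        rw [Polynomial.coeff_X_mul]
        by_cases hn : 3 ≤ n
        · rw [if_pos hn, ih _ (by omega)]
          refine if_congr (by omega) ?_ rfl
          congr 1
          omega
        · rw [if_neg hn, if_neg (by omega), Polynomial.coeff_zero]
      rw [h1, h3]
      split_ifs <;> first | omega | simp

theorem coeff_coeff_of_eq {A : PowerSeries (Polynomial ℚ)}
    (hA : A = 1 + PowerSeries.X * A ^ 2 +
      PowerSeries.X ^ 3 * PowerSeries.C (Polynomial.X - 1) * A ^ 3) (n k : ℕ) (hk : 1 ≤ k) :
    (PowerSeries.coeff n A).coeff k =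
        1 / (k : ℚ) * ∑ i ∈ Finset.Icc k (n / 3),
          (-1 : ℚ) ^ (i - k) *
            (Nat.multinomial Finset.univ ![n - 3 * i, n + 1 - i, k - 1, i - k] : ℚ) := by
  let e : Polynomial ℚ →+* Polynomial ℚ := Polynomial.compRingHom (Polynomial.X + 1)
  obtain ⟨D, hD⟩ : ∃ D, D = PowerSeries.map e A := ⟨_, rfl⟩
  have hDeq : D = 1 + PowerSeries.X * D ^ 2 +
      PowerSeries.X ^ 3 * PowerSeries.C Polynomial.X * D ^ 3 := by
    have h := congrArg (PowerSeries.map e) hA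
    simpa [← hD, e] using h
  have hco : ∀ j, (PowerSeries.coeff n D).coeff j =
      if 3 * j ≤ n then forestCount 1 (n - 3 * j) j else 0 := fun j => by
    simpa using coeff_coeff_pow hDeq 1 n j
  have hback : PowerSeries.coeff n A = (PowerSeries.coeff n D).comp (Polynomial.X - 1) := by
    simp [hD, e, Polynomial.comp_assoc]
  have hdeg : (PowerSeries.coeff n D).natDegree < n / 3 + 1 := by
    rw [Nat.lt_succ_iff, Polynomial.natDegree_le_iff_coeff_eq_zero]
    intro j hj
    rw [hco, if_neg (by omega)]
  rw [hback, Polynomial.comp, Polynomial.eval₂_eq_sum_range' _ hdeg, Polynomial.finsetSum_coeff,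
    Finset.mul_sum]
  symm
  apply Finset.sum_subset_zero_on_sdiff
  · intro i; simp only [Finset.mem_Icc, Finset.mem_range]; omega
  -- Terms with `i < k` vanish, as `(X - 1) ^ i` has degree below `k`.
  · intro i hi
    simp only [Finset.mem_sdiff, Finset.mem_Icc, Finset.mem_range] at hi
    rw [Polynomial.coeff_C_mul, show (Polynomial.X - 1 : Polynomial ℚ) =
      Polynomial.X + Polynomial.C (-1) by simp [sub_eq_add_neg], Polynomial.coeff_X_add_C_pow,
      Nat.choose_eq_zero_of_lt (by omega)]
    simp
  · intro i hi
    rw [Finset.mem_Icc] at hi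
    rw [Polynomial.coeff_C_mul, show (Polynomial.X - 1 : Polynomial ℚ) =
      Polynomial.X + Polynomial.C (-1) by simp [sub_eq_add_neg], Polynomial.coeff_X_add_C_pow,
      hco, if_pos (by omega), Nat.cast_choose ℚ hi.1,
      forestCount_eq (m := 0) (2 * n - 3 * i) (n + 1 - i) (by omega) (by omega)]
    -- The factor `i!` in the tree count cancels against `i.choose k`, leaving `k! = k * (k - 1)!`,
    -- the source of `1 / k`.
    have hm : ((Nat.multinomial Finset.univ ![n - 3 * i, n + 1 - i, k - 1, i - k] : ℕ) : ℚ) =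
        (2 * n - 3 * i)! / ((n - 3 * i)! * (n + 1 - i)! * (k - 1)! * (i - k)!) := by
      have h := Nat.multinomial_spec Finset.univ ![n - 3 * i, n + 1 - i, k - 1, i - k]
      simp only [Fin.prod_univ_four, Fin.sum_univ_four] at h
      simp only [Matrix.cons_val] at h
      rw [show n - 3 * i + (n + 1 - i) + (k - 1) + (i - k) = 2 * n - 3 * i by omega] at h
      rw [← h]
      push_cast
      field_simp
    rw [hm]
    obtain ⟨k, rfl⟩ : ∃ l, k = l + 1 := ⟨k - 1, by omega⟩
    rw [add_tsub_cancel_right, factorial_succ]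
    push_cast
    field_simp
    simp

end ConsecPattern

/-! ### Specialization to `ℤ[y, x]` and to `y = 1` -/

namespace ConsecPattern

theorem A_eq : A = 1 + (PowerSeries.X + PowerSeries.X ^ 2 * (1 - PowerSeries.C yVar)) *
        (PowerSeries.C yVar * (A - 1) + 1) ^ 2
      + PowerSeries.X ^ 3 * (PowerSeries.C xVar - 1) * PowerSeries.C yVar *
        (PowerSeries.C yVar * (A - 1) + 1) ^ 3 :=
  genFun_eq yVar xVar

theorem AOne_eq : AOne = 1 + PowerSeries.X * AOne ^ 2 +
    PowerSeries.X ^ 3 * PowerSeries.C (Polynomial.X - 1) * AOne ^ 3 := by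
  let e : MvPolynomial (Fin 2) ℤ →+* Polynomial ℤ :=
    (MvPolynomial.aeval ![(1 : Polynomial ℤ), Polynomial.X]).toRingHom
  have hy : e yVar = 1 := by simp [e, yVar]
  have hx : e xVar = Polynomial.X := by simp [e, xVar]
  have h := congrArg (PowerSeries.map e) A_eq
  have hA : PowerSeries.map e A = AOne := rfl
  simp only [map_add, map_mul, map_pow, map_sub, map_one, PowerSeries.map_X, PowerSeries.map_C,
    hA, hy, hx] at h
  rw [map_sub, map_one]
  linear_combination h

theorem AOne_coeff (n k : ℕ) (hk : 1 ≤ k) :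
    (((PowerSeries.coeff n AOne).coeff k : ℤ) : ℚ) =
      1 / (k : ℚ) * ∑ i ∈ Finset.Icc k (n / 3),
        (-1 : ℚ) ^ (i - k) *
          (Nat.multinomial Finset.univ ![n - 3 * i, n + 1 - i, k - 1, i - k] : ℚ) := by
  have h := congrArg (PowerSeries.map (Polynomial.mapRingHom (Int.castRingHom ℚ))) AOne_eq
  simp only [map_add, map_mul, map_pow, map_one, PowerSeries.map_X, PowerSeries.map_C] at h
  rw [← coeff_coeff_of_eq (by simpa using h) n k hk]
  simp

end ConsecPattern

theorem mainTheorem2 :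
    (let A := ConsecPattern.A
     let t : PowerSeries (MvPolynomial (Fin 2) ℤ) := PowerSeries.X
     let y : PowerSeries (MvPolynomial (Fin 2) ℤ) := PowerSeries.C ConsecPattern.yVar
     let x : PowerSeries (MvPolynomial (Fin 2) ℤ) := PowerSeries.C ConsecPattern.xVar
     A = 1 + (t + t ^ 2 * (1 - y)) * (y * (A - 1) + 1) ^ 2
        + t ^ 3 * (x - 1) * y * (y * (A - 1) + 1) ^ 3) ∧
    (∀ n k : ℕ, 1 ≤ k →
      (((PowerSeries.coeff n ConsecPattern.AOne).coeff k : ℤ) : ℚ) =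
        1 / (k : ℚ) * ∑ i ∈ Finset.Icc k (n / 3),
          (-1 : ℚ) ^ (i - k) *
            (Nat.multinomial Finset.univ ![n - 3 * i, n + 1 - i, k - 1, i - k] : ℚ)) := by
  exact ⟨ConsecPattern.A_eq, ConsecPattern.AOne_coeff⟩
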